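/- All Hilbert spaces are finite-dimensional. For a classical-quantum state $\rho_{XC}=\sum_x P_X(x)\,|x\rangle\langle x|\otimes\rho_{C|x}$ (with $P_X$ a probability distribution and each $\rho_{C|x}$ a density operator), the conditional min-entropy is $$H_{\min}(X|C)_\rho=\max_{\sigma_C}\ \max\{z\in\mathbb R:\ \rho_{XC}\le 2^{-z}\,\mathbb 1_X\otimes\sigma_C\},$$ where the outer maximum is over all density operators $\sigma_C$ (and the inner one is $-\infty$ if no such $z$ exists). The trace distance is $\delta(\rho,\sigma)=\tfrac12\operatorname{tr}\sqrt{(\rho-\sigma)^\dagger(\rho-\sigma)}$, and $\omega_m=2^{-m}\mathbb 1$ denotes the maximally mixed state on the space with orthonormal basis $\{|z\rangle\}_{z\in\{0,1\}^m}$. For $k_1,k_2,\varepsilon\in\mathbb R$, a function $\mathrm{Ext}:\{0,1\}^{n_1}\times\{0,1\}^{n_2}\to\{0,1\}^m$ is a $(k_1,k_2,\varepsilon)$ $X_1$-strong two-source extractor against quantum product-type knowledge if for all sources $X_1,X_2$ (with values in $\{0,1\}^{n_1}$, $\{0,1\}^{n_2}$) and all quantum side information $C=C_1C_2$ of the form $\rho_{X_1X_2C}=\rho_{X_1C_1}\otimes\rho_{X_2C_2}$,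 with $\rho_{X_1C_1}$ and $\rho_{X_2C_2}$ classical-quantum states satisfying $H_{\min}(X_1|C_1)\ge k_1$ and $H_{\min}(X_2|C_2)\ge k_2$, $$\delta\bigl(\rho_{\mathrm{Ext}(X_1,X_2)X_1C},\ \omega_m\otimes\rho_{X_1C}\bigr)\le\varepsilon ,$$ where the second $X_1$ is an additional register containing a copy of $X_1$, i.e. $\rho_{\mathrm{Ext}(X_1,X_2)X_1C}=\sum_{x_1,x_2}|\mathrm{Ext}(x_1,x_2)\rangle\langle \mathrm{Ext}(x_1,x_2)|\otimes|x_1\rangle\langle x_1|\otimes\langle x_1,x_2|\rho_{X_1X_2C}|x_1,x_2\rangle$. **Theorem.** Let $n,m,r$ be non-negative integers and let $\mathcal A=(A_1,\dots,A_m)$ be $n\times n$ matrices over the field $\mathbb F_2=\{0,1\}$ such that for every $s\in\{0,1\}^m\setminus\{0^m\}$ the matrix $A_s=\sum_{i=1}^m s_iA_i$ satisfies $\operatorname{rank}(A_s)\ge n-r$. Define $$\mathrm{deor}_{\mathcal A}:\{0,1\}^n\times\{0,1\}^n\to\{0,1\}^m,\qquad (x,y)\mapsto\bigl((A_1x)\cdot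 y,\dots,(A_mx)\cdot y\bigr),$$ with $\cdot$ the inner product modulo $2$. Then for all $k_1,k_2\in\mathbb R$, $\mathrm{deor}_{\mathcal A}$ is a $(k_1,k_2,\varepsilon)$ $X_1$-strong two-source extractor against quantum product-type knowledge, where $$\varepsilon=2^{-\frac{k_1+k_2+2-n-r-m}{2}} .$$ -/

import Mathlib

open scoped Kronecker MatrixOrder ComplexOrder

noncomputable section

namespace TwoSource

/-- Bit strings of length `n`, as vectors over the field with two elements. -/
abbrev BitStr (n : ℕ) : Type := Fin n → ZMod 2

section Quantum

variable {ι A B X C : Type} [Fintype ι] [DecidableEq ι] [Fintype A] [DecidableEq A]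
  [Fintype B] [DecidableEq B] [Fintype X] [DecidableEq X] [Fintype C] [DecidableEq C]

/-- Density operators on the finite-dimensional Hilbert space `ℂ^ι`:
positive semidefinite operators of trace one. -/
def IsDensity (ρ : Matrix ι ι ℂ) : Prop :=
  ρ.PosSemidef ∧ ρ.trace = 1

/-- The trace norm `‖S‖₁ = tr √(S† S)`. -/
def traceNorm (S : Matrix ι ι ℂ) : ℝ :=
  (CFC.sqrt (S.conjTranspose * S)).trace.re

/-- The trace distance `δ(ρ, σ) = ½ ‖ρ - σ‖₁`. -/
def traceDist (ρ σ : Matrix ι ι ℂ) : ℝ :=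
  (1 / 2) * traceNorm (ρ - σ)

/-- The rank one projector `[i] = |i⟩⟨i|` onto a vector of the preferred basis. -/
def proj (i : ι) : Matrix ι ι ℂ :=
  Matrix.single i i 1

/-- The maximally mixed state `𝟙 / d` on `ℂ^ι`, where `d = dim ℂ^ι`. -/
def maxMixed (ι : Type) [Fintype ι] [DecidableEq ι] : Matrix ι ι ℂ :=
  (Fintype.card ι : ℂ)⁻¹ • (1 : Matrix ι ι ℂ)

/-- `ρ_{XC}` is a classical-quantum state `∑ₓ P(x) |x⟩⟨x| ⊗ ρ_{C|x}`, with a probability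
distribution `P` and conditional density operators `ρ_{C|x}`. -/
def IsCQState (ρ : Matrix (X × C) (X × C) ℂ) : Prop :=
  ∃ (P : X → ℝ) (τ : X → Matrix C C ℂ),
    (∀ x, 0 ≤ P x) ∧ ∑ x, P x = 1 ∧ (∀ x, IsDensity (τ x)) ∧
      ρ = ∑ x, (P x : ℂ) • (proj x ⊗ₖ τ x)

/-- The min-entropy of `ρ_{AB}` relative to `σ_B`, as an extended real number: the largest `z`
with `ρ_{AB} ≤ 2^{-z} 𝟙_A ⊗ σ_B`, and `-∞` if there is no such `z`, that is, if
`ker (𝟙_A ⊗ σ_B) ⊄ ker ρ_{AB}`. -/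
def relMinEntropy (ρ : Matrix (A × B) (A × B) ℂ) (σ : Matrix B B ℂ) : EReal :=
  ⨆ (z : ℝ) (_ : ρ ≤ (2 : ℝ) ^ (-z) • ((1 : Matrix A A ℂ) ⊗ₖ σ)), (z : EReal)

/-- The conditional min-entropy `H_min(A|B)_ρ`: the best relative min-entropy over all density
operators `σ_B`. -/
def condMinEntropy (ρ : Matrix (A × B) (A × B) ℂ) : EReal :=
  ⨆ (σ : Matrix B B ℂ) (_ : IsDensity σ), relMinEntropy ρ σ

end Quantum

section Extractor

variable {X₁ X₂ Z C₁ C₂ : Type} [Fintype X₁] [DecidableEq X₁] [Fintype X₂] [DecidableEq X₂]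
  [Fintype Z] [DecidableEq Z] [Fintype C₁] [DecidableEq C₁] [Fintype C₂] [DecidableEq C₂]

/-- The subnormalized conditional operator `ρ_{C ∧ x₁,x₂} = ⟨x₁,x₂| ρ_{X₁C₁X₂C₂} |x₁,x₂⟩` on
`C = C₁C₂`. -/
def condOp (ρ : Matrix ((X₁ × C₁) × (X₂ × C₂)) ((X₁ × C₁) × (X₂ × C₂)) ℂ) (x₁ : X₁) (x₂ : X₂) :
    Matrix (C₁ × C₂) (C₁ × C₂) ℂ :=
  Matrix.of fun c c' => ρ ((x₁, c.1), (x₂, c.2)) ((x₁, c'.1), (x₂, c'.2))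

/-- The state `ρ_{Ext(X₁,X₂) X₁ C}`: the function `Ext` is applied to the two classical
registers, a copy of `X₁` is kept, and `C = C₁C₂` is left alone. -/
def outputState (Ext : X₁ → X₂ → Z)
    (ρ : Matrix ((X₁ × C₁) × (X₂ × C₂)) ((X₁ × C₁) × (X₂ × C₂)) ℂ) :
    Matrix (Z × (X₁ × (C₁ × C₂))) (Z × (X₁ × (C₁ × C₂))) ℂ :=
  ∑ x₁, ∑ x₂, proj (Ext x₁ x₂) ⊗ₖ (proj x₁ ⊗ₖ condOp ρ x₁ x₂)

/-- The reduced state `ρ_{X₁ C}`, that is, the partial trace of `ρ_{X₁C₁X₂C₂}` over `X₂`. -/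
def reducedState (ρ : Matrix ((X₁ × C₁) × (X₂ × C₂)) ((X₁ × C₁) × (X₂ × C₂)) ℂ) :
    Matrix (X₁ × (C₁ × C₂)) (X₁ × (C₁ × C₂)) ℂ :=
  Matrix.of fun a a' => ∑ x₂, ρ ((a.1, a.2.1), (x₂, a.2.2)) ((a'.1, a'.2.1), (x₂, a'.2.2))

end Extractor

/-- `Ext` is a `(k₁, k₂, ε)` `X₁`-strong two-source extractor against quantum product-type
knowledge. The side information `C₁`, `C₂` lives on Hilbert spaces `ℂ^{d₁}`, `ℂ^{d₂}` of
arbitrary finite dimensions. -/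
def IsX1StrongAgainstQuantumProduct {n₁ n₂ m : ℕ} (Ext : BitStr n₁ → BitStr n₂ → BitStr m)
    (k₁ k₂ ε : ℝ) : Prop :=
  ∀ (d₁ d₂ : ℕ)
    (ρ₁ : Matrix (BitStr n₁ × Fin d₁) (BitStr n₁ × Fin d₁) ℂ)
    (ρ₂ : Matrix (BitStr n₂ × Fin d₂) (BitStr n₂ × Fin d₂) ℂ),
    IsCQState ρ₁ → IsCQState ρ₂ →
    (k₁ : EReal) ≤ condMinEntropy ρ₁ → (k₂ : EReal) ≤ condMinEntropy ρ₂ →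
    traceDist (outputState Ext (ρ₁ ⊗ₖ ρ₂))
      (maxMixed (BitStr m) ⊗ₖ reducedState (ρ₁ ⊗ₖ ρ₂)) ≤ ε

/-- The function `(x, y) ↦ ((A₁ x) · y, …, (A_m x) · y)`, with inner products modulo two. -/
def deor {n m : ℕ} (A : Fin m → Matrix (Fin n) (Fin n) (ZMod 2)) (x y : BitStr n) : BitStr m :=
  fun i => (A i).mulVec x ⬝ᵥ y

/-- Every non-trivial combination `A_s = ∑ᵢ sᵢ Aᵢ`, `s ≠ 0`, has rank at least `n - r`. -/
def RankCondition {n m : ℕ} (A : Fin m → Matrix (Fin n) (Fin n) (ZMod 2)) (r : ℕ) : Prop :=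
  ∀ s : BitStr m, s ≠ 0 → (n : ℤ) - (r : ℤ) ≤ ((∑ i, s i • A i).rank : ℤ)

end TwoSource

end

/-! The difference of the two states is block diagonal, with blocks `M x ⊗ₖ E x z`, where `E x z`
weights the operators `N y` by the deviation of the output from uniform. A Cauchy-Schwarz bound
(`traceNorm_mul_le`) with weight `M x ⊗ₖ σ`, where `σ` dominates every `N y`, reduces its trace norm
to the second moments tr(E σ⁻¹ E). The side information on the first source enters only through tr(M
x) ≤ 2^(-z₁), so the sum over `x` becomes unweighted. By Parseval in `z`, the second moment is the
average over `s` of G(A_s x), without the term s = 0, where G(w) ≥ 0 is the quadratic form tr(N y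
σ⁻¹ N y') at the character of `w`. Each A_s is at most 2^r to one, so the sum over `x` costs a
factor 2^r; summing `G` over all `w` leaves 2^n times the diagonal (`sum_deviation_deor_le`), which
is at most 1 because N y ≤ σ gives tr(N y σ⁻¹ N y) ≤ tr(N y). -/

section Auxiliary

open scoped Matrix

set_option linter.unusedSectionVars false

namespace TwoSource

/-! ### Trace norm and trace inequalities -/

section TraceNorm

variable {ι : Type} [Fintype ι] [DecidableEq ι]

/-- `U` is the sign of `S` in its eigenbasis, with sign +1 on the kernel so that `U` squares to 1.
-/
theorem exists_unitary_traceNorm_eq {S : Matrix ι ι ℂ} (hS : S.IsHermitian) :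
    ∃ U : Matrix ι ι ℂ, U.IsHermitian ∧ U * U = 1 ∧ traceNorm S = (S * U).trace.re := by
  set V : Matrix ι ι ℂ := (hS.eigenvectorUnitary : Matrix ι ι ℂ) with hV
  have hVV : Vᴴ * V = 1 := Matrix.mem_unitaryGroup_iff'.1 hS.eigenvectorUnitary.2
  have hVV' : V * Vᴴ = 1 := Matrix.mem_unitaryGroup_iff.1 hS.eigenvectorUnitary.2
  set a : ι → ℝ := hS.eigenvalues
  set s : ι → ℝ := fun i => if 0 ≤ a i then 1 else -1
  have hspec : S = V * Matrix.diagonal (fun i => (a i : ℂ)) * Vᴴ := by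
    have h := hS.spectral_theorem
    rw [Unitary.conjStarAlgAut_apply] at h
    exact h
  have hconj (D E : Matrix ι ι ℂ) : (V * D * Vᴴ) * (V * E * Vᴴ) = V * (D * E) * Vᴴ := by
    calc _ = V * D * (Vᴴ * V) * E * Vᴴ := by simp only [Matrix.mul_assoc]
      _ = _ := by rw [hVV]; simp only [Matrix.mul_assoc, Matrix.mul_one]
  have hss (i : ι) : s i * s i = 1 := by simp only [s]; split_ifs <;> norm_num
  have has (i : ι) : 0 ≤ a i * s i := by
    simp only [s]; split_ifs with h
    · simpa using h
    · push Not at h; linarith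
  refine ⟨V * Matrix.diagonal (fun i => (s i : ℂ)) * Vᴴ, ?_, ?_, ?_⟩
  · apply Matrix.isHermitian_mul_mul_conjTranspose
    rw [Matrix.isHermitian_diagonal_iff]
    intro i; simp [IsSelfAdjoint]
  · rw [hconj, Matrix.diagonal_mul_diagonal]
    simp only [← Complex.ofReal_mul, hss]
    simp [hVV']
  · unfold traceNorm
    congr 2
    apply CFC.sqrt_unique
    · conv_rhs => rw [hS.eq]
      rw [hspec]
      simp only [hconj, Matrix.diagonal_mul_diagonal, ← Complex.ofReal_mul]
      congr 4
      funext i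
      congr 1
      linear_combination a i * a i * hss i
    · rw [Matrix.nonneg_iff_posSemidef]
      nth_rw 1 [hspec]
      rw [hconj, Matrix.diagonal_mul_diagonal]
      apply Matrix.PosSemidef.mul_mul_conjTranspose_same
      rw [Matrix.posSemidef_diagonal_iff]
      intro i
      rw [← Complex.ofReal_mul]
      exact Complex.zero_le_real.2 (has i)

theorem re_trace_nonneg {S : Matrix ι ι ℂ} (hS : S.PosSemidef) : 0 ≤ S.trace.re :=
  (Complex.nonneg_iff.1 hS.trace_nonneg).1

theorem trace_re_conjTranspose (S : Matrix ι ι ℂ) : Sᴴ.trace.re = S.trace.re := by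
  simp [Matrix.trace_conjTranspose]

/-- A weighted Cauchy-Schwarz bound for the trace norm of a Hermitian matrix `T * K`. -/
theorem traceNorm_mul_le {T K : Matrix ι ι ℂ} (hT : T.PosSemidef) (hTK : (T * K).IsHermitian)
    {t : ℝ} (ht : 0 < t) :
    traceNorm (T * K) ≤ (1 / 2) * (t⁻¹ * (Kᴴ * T * K).trace.re + t * T.trace.re) := by
  obtain ⟨U, hU, hUU, hn⟩ := exists_unitary_traceNorm_eq hTK
  -- Expanding this square gives the arithmetic-geometric form of Cauchy-Schwarz; both cross terms
  -- have real trace `traceNorm (T * K)`.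
  have h := re_trace_nonneg (hT.conjTranspose_mul_mul_same (K - (t : ℂ) • U))
  have h1 : (K - (t : ℂ) • U)ᴴ * T * (K - (t : ℂ) • U)
      = Kᴴ * T * K - (t : ℂ) • (Kᴴ * T * U) - (t : ℂ) • (U * T * K)
        + ((t : ℂ) * t) • (U * T * U) := by
    simp only [Matrix.conjTranspose_sub, Matrix.conjTranspose_smul, hU.eq, Matrix.sub_mul,
      Matrix.mul_sub, Matrix.smul_mul, Matrix.mul_smul, smul_sub, smul_smul, Complex.star_def,
      Complex.conj_ofReal]
    abel
  have h2 : (Kᴴ * T * U).trace.re = (T * K * U).trace.re := by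
    rw [← trace_re_conjTranspose, Matrix.trace_mul_comm (T * K)]
    simp [Matrix.conjTranspose_mul, hU.eq, hT.isHermitian.eq, Matrix.mul_assoc]
  have h3 : (U * T * K).trace = (T * K * U).trace := by
    rw [Matrix.mul_assoc, Matrix.trace_mul_comm]
  have h4 : (U * T * U).trace = T.trace := by
    rw [Matrix.trace_mul_comm, ← Matrix.mul_assoc, hUU, Matrix.one_mul]
  rw [h1] at h
  simp only [Matrix.trace_add, Matrix.trace_sub, Matrix.trace_smul, h3, h4, smul_eq_mul,
    Complex.add_re, Complex.sub_re, ← Complex.ofReal_mul, Complex.re_ofReal_mul, h2] at h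
  rw [hn]
  have h5 : (T * K * U).trace.re * (2 * t) ≤ (Kᴴ * T * K).trace.re + t * t * T.trace.re := by
    linarith
  have h6 : (1 / 2) * (t⁻¹ * (Kᴴ * T * K).trace.re + t * T.trace.re)
      = ((Kᴴ * T * K).trace.re + t * t * T.trace.re) / (2 * t) := by
    field_simp
  rw [h6, le_div_iff₀ (by positivity)]
  exact h5

theorem re_trace_mul_inv_mul_le {T σ : Matrix ι ι ℂ} (hσ : σ.PosDef) (hT : T.PosSemidef)
    (hle : (σ - T).PosSemidef) : (T * σ⁻¹ * T).trace.re ≤ T.trace.re := by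
  have hdet : IsUnit σ.det := (Matrix.isUnit_iff_isUnit_det σ).1 hσ.isUnit
  have hl : σ⁻¹ * σ = 1 := Matrix.nonsing_inv_mul σ hdet
  have hr : σ * σ⁻¹ = 1 := Matrix.mul_nonsing_inv σ hdet
  have hi : σ⁻¹ᴴ = σ⁻¹ := hσ.isHermitian.inv.eq
  set E := σ - T with hE
  set R := σ⁻¹
  have hEh : Eᴴ = E := hle.isHermitian.eq
  have hTh : Tᴴ = T := hT.isHermitian.eq
  -- A sum of two congruences of positive operators, so T σ⁻¹ T ≤ T without square roots.
  have key : T - T * R * T = (E * R) * T * (E * R)ᴴ + (T * R) * E * (T * R)ᴴ := by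
    rw [Matrix.conjTranspose_mul, Matrix.conjTranspose_mul, hEh, hTh, hi]
    have h1 : E * R = 1 - T * R := by rw [hE, Matrix.sub_mul, hr]
    have h2 : R * E = 1 - R * T := by rw [hE, Matrix.mul_sub, hl]
    have h3 : T * R * E = T - T * R * T := by
      rw [Matrix.mul_assoc, h2, Matrix.mul_sub, Matrix.mul_one, Matrix.mul_assoc]
    rw [h1, h2, h3]
    noncomm_ring
  have h1 := re_trace_nonneg (hT.mul_mul_conjTranspose_same (E * R))
  have h2 := re_trace_nonneg (hle.mul_mul_conjTranspose_same (T * R))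
  have h3 := congrArg (fun M => (Matrix.trace M).re) key
  simp only [Matrix.trace_sub, Matrix.trace_add, Complex.sub_re, Complex.add_re] at h3
  linarith

end TraceNorm

/-! ### Block diagonal operators and classical-quantum states -/

section BlockSum

variable {X C : Type} [Fintype X] [DecidableEq X] [Fintype C] [DecidableEq C]

/-- The block diagonal operator `∑ₓ |x⟩⟨x| ⊗ Mₓ`. -/
noncomputable def blockSum (M : X → Matrix C C ℂ) : Matrix (X × C) (X × C) ℂ :=
  ∑ x, proj x ⊗ₖ M x

theorem blockSum_apply (M : X → Matrix C C ℂ) (a b : X × C) :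
    blockSum M a b = if a.1 = b.1 then M a.1 a.2 b.2 else 0 := by
  simp only [blockSum, Matrix.sum_apply, Matrix.kroneckerMap_apply, proj, Matrix.single_apply]
  split_ifs with h
  · rw [Finset.sum_eq_single a.1]
    · simp [h]
    · intro x _ hx; simp [hx]
    · simp
  · apply Finset.sum_eq_zero
    intro x _
    rw [if_neg, zero_mul]
    rintro ⟨h1, h2⟩
    exact h (h1.symm.trans h2)

theorem blockSum_mul (M N : X → Matrix C C ℂ) :
    blockSum M * blockSum N = blockSum fun x => M x * N x := by
  ext a b
  simp only [Matrix.mul_apply, blockSum_apply, Fintype.sum_prod_type]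
  rw [Finset.sum_eq_single a.1]
  · by_cases h : a.1 = b.1 <;> simp [h]
  · intro x _ hx; simp [hx.symm]
  · simp

theorem blockSum_conjTranspose (M : X → Matrix C C ℂ) :
    (blockSum M)ᴴ = blockSum fun x => (M x)ᴴ := by
  ext a b
  simp only [Matrix.conjTranspose_apply, blockSum_apply]
  by_cases h : a.1 = b.1
  · simp [h]
  · simp [h, Ne.symm h]

theorem blockSum_trace (M : X → Matrix C C ℂ) : (blockSum M).trace = ∑ x, (M x).trace := by
  simp [Matrix.trace, blockSum_apply, Fintype.sum_prod_type]

theorem proj_posSemidef (x : X) : (proj x : Matrix X X ℂ).PosSemidef := by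
  have : (proj x : Matrix X X ℂ) = Matrix.diagonal (Pi.single x 1) := by
    rw [proj, Matrix.diagonal_single]
  rw [this, Matrix.posSemidef_diagonal_iff]
  intro i
  by_cases h : i = x
  · subst h; simp
  · simp [h]

theorem blockSum_posSemidef {M : X → Matrix C C ℂ} (hM : ∀ x, (M x).PosSemidef) :
    (blockSum M).PosSemidef :=
  Matrix.posSemidef_sum _ fun x _ => (proj_posSemidef x).kronecker (hM x)

theorem exists_blockSum_of_isCQState {ρ : Matrix (X × C) (X × C) ℂ} (h : IsCQState ρ) :
    ∃ M : X → Matrix C C ℂ, (∀ x, (M x).PosSemidef) ∧ ∑ x, (M x).trace = 1 ∧ ρ = blockSum M := by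
  obtain ⟨P, τ, hP, hP1, hτ, rfl⟩ := h
  refine ⟨fun x => (P x : ℂ) • τ x, fun x => ?_, ?_, ?_⟩
  · exact (hτ x).1.smul (Complex.zero_le_real.2 (hP x))
  · simp only [Matrix.trace_smul, (hτ _).2, smul_eq_mul, mul_one]
    exact_mod_cast hP1
  · simp [blockSum, Matrix.kronecker_smul]

/-- A lower bound on the conditional min-entropy yields an invertible dominating operator. -/
theorem exists_posDef_dominating {M : X → Matrix C C ℂ} {k z : ℝ} (hM : ∑ x, (M x).trace = 1)
    (hk : (k : EReal) ≤ condMinEntropy (blockSum M)) (hz : z < k) :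
    ∃ σ : Matrix C C ℂ, σ.PosDef ∧ σ.trace.re = 2 ^ (-z) ∧ ∀ x, (σ - M x).PosSemidef := by
  have hlt : (z : EReal) < condMinEntropy (blockSum M) :=
    (EReal.coe_lt_coe_iff.2 hz).trans_le hk
  simp only [condMinEntropy, relMinEntropy, lt_iSup_iff] at hlt
  obtain ⟨σ, hσ, w, hle, hzw⟩ := hlt
  rw [EReal.coe_lt_coe_iff] at hzw
  have hC : Nonempty C := by
    by_contra h
    rw [not_nonempty_iff] at h
    simp [Matrix.trace] at hM
  have hd : (0 : ℝ) < Fintype.card C := by exact_mod_cast Fintype.card_pos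
  set c : ℝ := 2 ^ (-w) with hc
  have hcpos : 0 < c := by positivity
  have hcz : c < 2 ^ (-z) := Real.rpow_lt_rpow_of_exponent_lt (by norm_num) (by linarith)
  -- The slack between `z` and `w` is spread as a multiple of the identity, which makes the operator
  -- invertible and its trace exactly 2^(-z).
  set δ : ℝ := (2 ^ (-z) - c) / Fintype.card C
  have hδ : 0 < δ := div_pos (by linarith) hd
  have h1 : ((δ : ℂ) • (1 : Matrix C C ℂ)).PosDef :=
    Matrix.PosDef.one.smul (Complex.zero_lt_real.2 hδ)
  have h2 : ((c : ℂ) • σ).PosSemidef := hσ.1.smul (Complex.zero_le_real.2 hcpos.le)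
  refine ⟨(c : ℂ) • σ + (δ : ℂ) • 1, Matrix.PosDef.posSemidef_add h2 h1, ?_, fun x => ?_⟩
  · rw [Matrix.trace_add, Matrix.trace_smul, Matrix.trace_smul, hσ.2, Matrix.trace_one]
    simp only [smul_eq_mul, mul_one, Complex.add_re, Complex.ofReal_re, Complex.re_ofReal_mul,
      Complex.natCast_re, δ]
    field_simp
    ring
  · rw [Matrix.le_iff] at hle
    have h3 := hle.submatrix (fun i : C => (x, i))
    have h4 : (c • ((1 : Matrix X X ℂ) ⊗ₖ σ) - blockSum M).submatrix
        (fun i : C => (x, i)) (fun i : C => (x, i)) = (c : ℂ) • σ - M x := by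
      ext i j
      simp [blockSum_apply]
    rw [h4] at h3
    have h5 := h3.add h1.posSemidef
    rwa [← add_sub_right_comm] at h5

end BlockSum

/-! ### Characters of F₂ⁿ and fibres of matrices -/

section Characters

/-- The nontrivial character `a ↦ (-1)^a` of the field with two elements. -/
noncomputable def sgn (a : ZMod 2) : ℝ := if a = 0 then 1 else -1

theorem sgn_add : ∀ a b : ZMod 2, sgn (a + b) = sgn a * sgn b := by
  have h : ∀ a : ZMod 2, a = 0 ∨ a = 1 := by decide
  have h11 : (1 : ZMod 2) + 1 = 0 := by decide
  intro a b
  rcases h a with rfl | rfl <;> rcases h b with rfl | rfl <;> simp [sgn, h11]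

theorem sgn_zero : sgn 0 = 1 := by simp [sgn]

theorem sum_sgn_dotProduct {n : ℕ} (u : Fin n → ZMod 2) :
    ∑ w : Fin n → ZMod 2, sgn (w ⬝ᵥ u) = if u = 0 then 2 ^ n else 0 := by
  split_ifs with h
  · subst h
    simp [sgn_zero, ZMod.card]
  · obtain ⟨i, hi⟩ : ∃ i, u i ≠ 0 := by
      by_contra! h'
      exact h (funext h')
    -- Translation by the `i`-th basis vector flips every sign, so the sum equals its own negative.
    have h1 := Equiv.sum_comp (Equiv.addRight (Pi.single i (1 : ZMod 2)))
      (fun w : Fin n → ZMod 2 => sgn (w ⬝ᵥ u))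
    have h2 : sgn (u i) = -1 := by simp [sgn, hi]
    simp only [Equiv.coe_addRight, add_dotProduct, single_dotProduct, one_mul, sgn_add, h2, ← Finset.sum_mul] at h1
    linarith

/-- A nonempty fibre is a coset of the kernel, whose dimension is at most `r` by rank-nullity. -/
theorem card_ker_mulVec_le {n r : ℕ} (M : Matrix (Fin n) (Fin n) (ZMod 2))
    (hM : (n : ℤ) - r ≤ M.rank) (w : Fin n → ZMod 2) :
    (Finset.univ.filter fun x : Fin n → ZMod 2 => M.mulVec x = w).card ≤ 2 ^ r := by
  rcases (Finset.univ.filter fun x : Fin n → ZMod 2 => M.mulVec x = w).eq_empty_or_nonempty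
    with h | ⟨x₀, hx₀⟩
  · simp [h]
  have hx₀ : M.mulVec x₀ = w := by simpa using hx₀
  have h1 : (Finset.univ.filter fun x : Fin n → ZMod 2 => M.mulVec x = w).card
      ≤ Nat.card (LinearMap.ker M.mulVecLin) := by
    rw [← SetLike.coe_sort_coe, Nat.card_coe_set_eq, ← Set.ncard_coe_finset]
    refine Set.ncard_le_ncard_of_injOn (fun x => x - x₀) (fun x hx => ?_)
      (fun x _ y _ h => sub_left_injective h) (Set.toFinite _)
    have hx : M.mulVec x = w := by simpa using hx
    simp [Matrix.mulVec_sub, hx, hx₀]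
  have h2 := M.mulVecLin.finrank_range_add_finrank_ker
  have h3 : Module.finrank (ZMod 2) (LinearMap.range M.mulVecLin) = M.rank := rfl
  rw [h3, Module.finrank_fin_fun] at h2
  rw [Module.natCard_eq_pow_finrank (K := ZMod 2), Nat.card_zmod] at h1
  exact h1.trans (Nat.pow_le_pow_right (by norm_num) (by omega))

theorem sum_comp_mulVec_le {n r : ℕ} (M : Matrix (Fin n) (Fin n) (ZMod 2))
    (hM : (n : ℤ) - r ≤ M.rank) {G : (Fin n → ZMod 2) → ℝ} (hG : ∀ w, 0 ≤ G w) :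
    ∑ x, G (M.mulVec x) ≤ 2 ^ r * ∑ w, G w := by
  rw [← Finset.sum_fiberwise (s := Finset.univ) (g := fun x => M.mulVec x), Finset.mul_sum]
  refine Finset.sum_le_sum fun w _ => ?_
  rw [Finset.sum_congr rfl (g := fun _ => G w), Finset.sum_const, nsmul_eq_mul]
  · gcongr
    · exact hG w
    · exact_mod_cast card_ker_mulVec_le M hM w
  · intro x hx
    rw [(Finset.mem_filter.1 hx).2]

end Characters

/-! ### Second moment of the deviation from uniform -/

section Collision

variable {n m : ℕ}

theorem sgn_dotProduct_sub (s u v : Fin m → ZMod 2) :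
    sgn (s ⬝ᵥ (u - v)) = sgn (s ⬝ᵥ u) * sgn (s ⬝ᵥ v) := by
  rw [dotProduct_sub, CharTwo.sub_eq_add, sgn_add]

theorem dotProduct_deor (A : Fin m → Matrix (Fin n) (Fin n) (ZMod 2)) (s : BitStr m)
    (x y : BitStr n) : s ⬝ᵥ deor A x y = (∑ i, s i • A i).mulVec x ⬝ᵥ y := by
  rw [Matrix.sum_mulVec, sum_dotProduct]
  simp [dotProduct, deor, Matrix.smul_mulVec, Finset.mul_sum, mul_assoc]

/-- The coefficient of `y` in the deviation from uniform at the output `z`, given `x`. -/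
noncomputable def deviation {Y : Type} (f : Y → BitStr m) (z : BitStr m) (y : Y) : ℝ :=
  (if f y = z then 1 else 0) - (2 ^ m)⁻¹

/-- Parseval on F₂ᵐ: subtracting the uniform weight removes exactly the trivial character. -/
theorem sum_deviation_mul {Y : Type} (f : Y → BitStr m) (y y' : Y) :
    ∑ z, deviation f z y * deviation f z y' =
      (2 ^ m)⁻¹ * ∑ s ∈ Finset.univ.erase 0, sgn (s ⬝ᵥ f y) * sgn (s ⬝ᵥ f y') := by
  have h := sum_sgn_dotProduct (f y - f y')
  rw [← Finset.add_sum_erase _ _ (Finset.mem_univ 0), zero_dotProduct, sgn_zero] at h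
  simp only [sgn_dotProduct_sub, sub_eq_zero] at h
  have hm : (2 : ℝ) ^ m ≠ 0 := by positivity
  rw [eq_sub_of_add_eq' h]
  simp only [deviation, sub_mul, mul_sub, Finset.sum_sub_distrib, ite_mul, one_mul, zero_mul,
    Finset.sum_ite_eq, Finset.mem_univ, if_true, mul_ite, mul_one, mul_zero, Finset.sum_const,
    Finset.card_univ, Fintype.card_fun, ZMod.card, Fintype.card_fin, nsmul_eq_mul]
  by_cases hy : f y = f y'
  · simp [hy, hm]
  · simp [hy, hm]

/-- Orthogonality of characters kills the off-diagonal terms. -/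
theorem sum_character_form (B : BitStr n → BitStr n → ℝ) :
    ∑ w : BitStr n, ∑ y, ∑ y', sgn (w ⬝ᵥ y) * sgn (w ⬝ᵥ y') * B y y' = 2 ^ n * ∑ y, B y y := by
  rw [Finset.sum_comm, Finset.mul_sum]
  refine Finset.sum_congr rfl fun y _ => ?_
  rw [Finset.sum_comm]
  simp only [← sgn_dotProduct_sub, ← Finset.sum_mul, sum_sgn_dotProduct, sub_eq_zero, ite_mul,
    zero_mul, Finset.sum_ite_eq, Finset.mem_univ, if_true]

theorem sum_deviation_deor_le {A : Fin m → Matrix (Fin n) (Fin n) (ZMod 2)} {r : ℕ}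
    (hA : RankCondition A r) {B : BitStr n → BitStr n → ℝ}
    (hB : ∀ a : BitStr n → ℝ, 0 ≤ ∑ y, ∑ y', a y * a y' * B y y') :
    ∑ x, ∑ z, ∑ y, ∑ y', deviation (deor A x) z y * deviation (deor A x) z y' * B y y'
      ≤ 2 ^ r * (2 ^ n * ∑ y, B y y) := by
  set G : BitStr n → ℝ := fun w => ∑ y, ∑ y', sgn (w ⬝ᵥ y) * sgn (w ⬝ᵥ y') * B y y' with hG
  have hG0 (w : BitStr n) : 0 ≤ G w := hB _
  have h1 (x : BitStr n) :
      ∑ z, ∑ y, ∑ y', deviation (deor A x) z y * deviation (deor A x) z y' * B y y'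
        = (2 ^ m)⁻¹ * ∑ s ∈ Finset.univ.erase (0 : BitStr m), G ((∑ i, s i • A i).mulVec x) := by
    rw [Finset.sum_comm]
    have h2 (y : BitStr n) :
        ∑ z, ∑ y', deviation (deor A x) z y * deviation (deor A x) z y' * B y y'
          = ∑ s ∈ Finset.univ.erase (0 : BitStr m), ∑ y', (2 ^ m)⁻¹ *
            (sgn (s ⬝ᵥ deor A x y) * sgn (s ⬝ᵥ deor A x y') * B y y') := by
      rw [Finset.sum_comm, Finset.sum_comm (s := Finset.univ.erase 0)]
      refine Finset.sum_congr rfl fun y' _ => ?_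
      rw [← Finset.sum_mul, sum_deviation_mul, Finset.mul_sum, Finset.sum_mul]
      exact Finset.sum_congr rfl fun s _ => by ring
    simp only [h2]
    rw [Finset.sum_comm, Finset.mul_sum]
    refine Finset.sum_congr rfl fun s _ => ?_
    simp only [hG, Finset.mul_sum, dotProduct_deor]
  simp only [h1]
  rw [← Finset.mul_sum, Finset.sum_comm, ← sum_character_form B]
  have h3 : ∑ s ∈ Finset.univ.erase (0 : BitStr m), ∑ x, G ((∑ i, s i • A i).mulVec x)
      ≤ ∑ s ∈ Finset.univ.erase (0 : BitStr m), 2 ^ r * ∑ w, G w :=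
    Finset.sum_le_sum fun s hs =>
      sum_comp_mulVec_le _ (hA s (Finset.ne_of_mem_erase hs)) hG0
  have h4 : 0 ≤ 2 ^ r * ∑ w, G w := mul_nonneg (by positivity) (Finset.sum_nonneg fun w _ => hG0 w)
  have h5 : ((Finset.univ.erase (0 : BitStr m)).card : ℝ) ≤ 2 ^ m := by
    have := Finset.card_erase_le (s := Finset.univ) (a := (0 : BitStr m))
    simp only [Finset.card_univ, Fintype.card_fun, ZMod.card, Fintype.card_fin] at this
    exact_mod_cast this
  rw [Finset.sum_const, nsmul_eq_mul] at h3
  -- The fewer than 2^m nonzero `s` are absorbed by the Parseval factor 2^(-m).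
  rw [inv_mul_le_iff₀ (by positivity)]
  exact h3.trans (mul_le_mul_of_nonneg_right h5 h4)

end Collision

/-! ### Distance of the extractor output from uniform -/

section Output

variable {X₁ X₂ C₁ C₂ : Type} [Fintype X₁] [DecidableEq X₁] [Fintype X₂] [DecidableEq X₂]
  [Fintype C₁] [DecidableEq C₁] [Fintype C₂] [DecidableEq C₂] {m : ℕ}

theorem outputState_sub_eq (f : X₁ → X₂ → BitStr m) (M : X₁ → Matrix C₁ C₁ ℂ)
    (N : X₂ → Matrix C₂ C₂ ℂ) :
    outputState f (blockSum M ⊗ₖ blockSum N) -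
        maxMixed (BitStr m) ⊗ₖ reducedState (blockSum M ⊗ₖ blockSum N) =
      blockSum fun z => blockSum fun x => M x ⊗ₖ ∑ y, (deviation (f x) z y : ℂ) • N y := by
  have h1 (x : X₁) (y : X₂) : condOp (blockSum M ⊗ₖ blockSum N) x y = M x ⊗ₖ N y := by
    ext a b
    simp [condOp, blockSum_apply]
  have h2 : reducedState (blockSum M ⊗ₖ blockSum N) = blockSum fun x => M x ⊗ₖ ∑ y, N y := by
    ext a b
    simp only [reducedState, Matrix.of_apply, Matrix.kroneckerMap_apply, blockSum_apply,
      Matrix.sum_apply, if_true, ite_mul, zero_mul]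
    split_ifs <;> simp [Finset.mul_sum]
  have h3 : outputState f (blockSum M ⊗ₖ blockSum N) = blockSum fun z => blockSum fun x =>
      M x ⊗ₖ ∑ y, (if f x y = z then (1 : ℂ) else 0) • N y := by
    ext a b
    simp only [outputState, h1, Matrix.sum_apply, Matrix.kroneckerMap_apply, blockSum_apply,
      Matrix.smul_apply, proj, Matrix.single_apply]
    by_cases hz : a.1 = b.1
    · by_cases hx : a.2.1 = b.2.1
      · rw [Finset.sum_eq_single a.2.1]
        · simp only [hz, hx, and_self, if_true, smul_eq_mul, Finset.mul_sum]
          exact Finset.sum_congr rfl fun y _ => by split_ifs <;> simp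
        · intro x _ h
          simp [h]
        · simp
      · rw [if_pos hz, if_neg hx]
        refine Finset.sum_eq_zero fun x _ => Finset.sum_eq_zero fun y _ => ?_
        have : ¬(x = a.2.1 ∧ x = b.2.1) := fun h => hx (h.1.symm.trans h.2)
        simp [this]
    · rw [if_neg hz]
      refine Finset.sum_eq_zero fun x _ => Finset.sum_eq_zero fun y _ => ?_
      have : ¬(f x y = a.1 ∧ f x y = b.1) := fun h => hz (h.1.symm.trans h.2)
      simp [this]
  rw [h2, h3]
  ext a b
  simp only [Matrix.sub_apply, maxMixed, Matrix.kroneckerMap_apply, blockSum_apply,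
    Matrix.smul_apply, Matrix.one_apply, Matrix.sum_apply, smul_eq_mul, deviation]
  by_cases hz : a.1 = b.1
  · by_cases hx : a.2.1 = b.2.1
    · simp only [hz, hx, if_true]
      have hc : ((Fintype.card (BitStr m) : ℕ) : ℂ) = 2 ^ m := by
        simp [ZMod.card]
      push_cast
      rw [hc]
      simp only [sub_mul, Finset.sum_sub_distrib, ← Finset.mul_sum]
      simp only [apply_ite (Complex.ofReal), Complex.ofReal_one, Complex.ofReal_zero]
      ring
    · simp [hx]
  · simp [hz]

/-- A bound on the distance from uniform by the second moments of the deviation operators. -/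
theorem traceDist_output_le (f : X₁ → X₂ → BitStr m) {M : X₁ → Matrix C₁ C₁ ℂ}
    {N : X₂ → Matrix C₂ C₂ ℂ} {σ : Matrix C₂ C₂ ℂ} (hM : ∀ x, (M x).PosSemidef)
    (hM1 : ∑ x, (M x).trace = 1) (hN : ∀ y, (N y).PosSemidef) (hσ : σ.PosDef)
    {t : ℝ} (ht : 0 < t) :
    traceDist (outputState f (blockSum M ⊗ₖ blockSum N))
        (maxMixed (BitStr m) ⊗ₖ reducedState (blockSum M ⊗ₖ blockSum N)) ≤
      (1 / 4) * (t⁻¹ * ∑ x, (M x).trace.re * ∑ z, ∑ y, ∑ y',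
          deviation (f x) z y * deviation (f x) z y' * (N y * σ⁻¹ * N y').trace.re
        + t * (2 ^ m * σ.trace.re)) := by
  have hdet : IsUnit σ.det := (Matrix.isUnit_iff_isUnit_det σ).1 hσ.isUnit
  have hr : σ * σ⁻¹ = 1 := Matrix.mul_nonsing_inv σ hdet
  set E : X₁ → BitStr m → Matrix C₂ C₂ ℂ := fun x z => ∑ y, (deviation (f x) z y : ℂ) • N y with hE
  have hEh (x : X₁) (z : BitStr m) : (E x z)ᴴ = E x z := by
    simp [hE, Matrix.conjTranspose_sum, Matrix.conjTranspose_smul, (hN _).isHermitian.eq]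
  set T := blockSum fun _ : BitStr m => blockSum fun x => M x ⊗ₖ σ with hT
  -- `K` cancels `σ` from `T`, so that `T * K` is the deviation operator and Kᴴ T K contains E σ⁻¹
  -- E.
  set K := blockSum fun z : BitStr m => blockSum fun x : X₁ => (1 : Matrix C₁ C₁ ℂ) ⊗ₖ (σ⁻¹ * E x z)
    with hK
  have hTK : T * K = blockSum fun z => blockSum fun x => M x ⊗ₖ E x z := by
    simp only [hT, hK, blockSum_mul, ← Matrix.mul_kronecker_mul, Matrix.mul_one,
      ← Matrix.mul_assoc, hr, Matrix.one_mul]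
  have hTK' : (T * K).IsHermitian := by
    rw [hTK, Matrix.IsHermitian]
    simp only [blockSum_conjTranspose, Matrix.conjTranspose_kronecker, hEh, (hM _).isHermitian.eq]
  have hTpos : T.PosSemidef := blockSum_posSemidef fun _ => blockSum_posSemidef fun x =>
    (hM x).kronecker hσ.posSemidef
  have him (x : X₁) : (M x).trace.im = 0 := (Complex.nonneg_iff.1 (hM x).trace_nonneg).2.symm
  have htr : T.trace.re = 2 ^ m * σ.trace.re := by
    simp only [hT, blockSum_trace, Matrix.trace_kronecker, ← Finset.sum_mul, hM1, one_mul,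
      Finset.sum_const, Finset.card_univ, Fintype.card_fun, ZMod.card, Fintype.card_fin,
      nsmul_eq_mul]
    rw [← Complex.ofReal_natCast, Complex.re_ofReal_mul]
    push_cast
    rfl
  have hq (x : X₁) (z : BitStr m) : (E x z * σ⁻¹ * E x z).trace.re = ∑ y, ∑ y',
      deviation (f x) z y * deviation (f x) z y' * (N y * σ⁻¹ * N y').trace.re := by
    simp only [hE, Finset.sum_mul, Finset.mul_sum, Matrix.smul_mul, Matrix.mul_smul,
      Matrix.trace_sum, Matrix.trace_smul, smul_eq_mul, Complex.re_sum, Complex.re_ofReal_mul]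
    rw [Finset.sum_comm]
    exact Finset.sum_congr rfl fun y _ => Finset.sum_congr rfl fun y' _ => by ring
  have hKT : (Kᴴ * T * K).trace.re = ∑ x, (M x).trace.re * ∑ z, ∑ y, ∑ y',
      deviation (f x) z y * deviation (f x) z y' * (N y * σ⁻¹ * N y').trace.re := by
    rw [Matrix.mul_assoc, hTK, hK]
    simp only [blockSum_conjTranspose, blockSum_mul, blockSum_trace,
      Matrix.conjTranspose_kronecker, Matrix.conjTranspose_mul, Matrix.conjTranspose_one, hEh,
      hσ.isHermitian.inv.eq, ← Matrix.mul_kronecker_mul, Matrix.one_mul, Matrix.trace_kronecker,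
      Complex.re_sum, Complex.mul_re, him, zero_mul, sub_zero, hq]
    rw [Finset.sum_comm]
    simp only [Finset.mul_sum]
  have h := traceNorm_mul_le hTpos hTK' ht
  rw [hTK, htr] at h
  rw [traceDist, outputState_sub_eq, ← hKT]
  linarith

end Output

/-! ### The bound for `deor` and the limit of the entropy parameters -/

theorem traceDist_deor_le {n m r : ℕ} {A : Fin m → Matrix (Fin n) (Fin n) (ZMod 2)}
    (hA : RankCondition A r) {C₁ C₂ : Type} [Fintype C₁] [DecidableEq C₁] [Fintype C₂]
    [DecidableEq C₂] {M : BitStr n → Matrix C₁ C₁ ℂ} {N : BitStr n → Matrix C₂ C₂ ℂ}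
    (hM : ∀ x, (M x).PosSemidef) (hM1 : ∑ x, (M x).trace = 1)
    (hN : ∀ y, (N y).PosSemidef) (hN1 : ∑ y, (N y).trace = 1) {k₁ k₂ : ℝ}
    (h₁ : (k₁ : EReal) ≤ condMinEntropy (blockSum M))
    (h₂ : (k₂ : EReal) ≤ condMinEntropy (blockSum N))
    {z₁ z₂ : ℝ} (hz₁ : z₁ < k₁) (hz₂ : z₂ < k₂) :
    traceDist (outputState (deor A) (blockSum M ⊗ₖ blockSum N))
        (maxMixed (BitStr m) ⊗ₖ reducedState (blockSum M ⊗ₖ blockSum N)) ≤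
      2 ^ (-((z₁ + z₂ + 2 - n - r - m) / 2)) := by
  obtain ⟨τ, -, hτ1, hτM⟩ := exists_posDef_dominating hM1 h₁ hz₁
  obtain ⟨σ, hσ, hσ1, hσN⟩ := exists_posDef_dominating hN1 h₂ hz₂
  set B : BitStr n → BitStr n → ℝ := fun y y' => (N y * σ⁻¹ * N y').trace.re
  have hB (a : BitStr n → ℝ) : 0 ≤ ∑ y, ∑ y', a y * a y' * B y y' := by
    have hS : (∑ y, (a y : ℂ) • N y)ᴴ = ∑ y, (a y : ℂ) • N y := by
      simp [Matrix.conjTranspose_sum, Matrix.conjTranspose_smul, (hN _).isHermitian.eq]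
    have h := re_trace_nonneg
      (hσ.inv.posSemidef.conjTranspose_mul_mul_same (∑ y, (a y : ℂ) • N y))
    rw [hS] at h
    simp only [Finset.sum_mul, Finset.mul_sum, Matrix.smul_mul, Matrix.mul_smul,
      Matrix.trace_sum, Matrix.trace_smul, smul_eq_mul, Complex.re_sum, Complex.re_ofReal_mul] at h
    rw [Finset.sum_comm] at h
    refine h.trans_eq (Finset.sum_congr rfl fun y _ => Finset.sum_congr rfl fun y' _ => ?_)
    ring
  have hBd : ∑ y, B y y ≤ 1 := by
    have h := congrArg Complex.re hN1
    rw [Complex.re_sum, Complex.one_re] at h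
    rw [← h]
    exact Finset.sum_le_sum fun y _ => re_trace_mul_inv_mul_le hσ (hN y) (hσN y)
  have hP (x : BitStr n) : (M x).trace.re ≤ 2 ^ (-z₁) := by
    have h := re_trace_nonneg (hτM x)
    rw [Matrix.trace_sub, Complex.sub_re, hτ1] at h
    linarith
  have hsum : ∑ x, (M x).trace.re * ∑ z, ∑ y, ∑ y',
      deviation (deor A x) z y * deviation (deor A x) z y' * B y y'
        ≤ 2 ^ (-z₁) * (2 ^ r * 2 ^ n) := by
    calc _ ≤ ∑ x, (2 : ℝ) ^ (-z₁) * ∑ z, ∑ y, ∑ y',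
          deviation (deor A x) z y * deviation (deor A x) z y' * B y y' :=
          Finset.sum_le_sum fun x _ => mul_le_mul_of_nonneg_right (hP x)
            (Finset.sum_nonneg fun z _ => hB _)
      _ ≤ 2 ^ (-z₁) * (2 ^ r * (2 ^ n * ∑ y, B y y)) := by
          rw [← Finset.mul_sum]
          exact mul_le_mul_of_nonneg_left (sum_deviation_deor_le hA hB) (by positivity)
      _ ≤ 2 ^ (-z₁) * (2 ^ r * (2 ^ n * 1)) := by gcongr
      _ = _ := by ring
  -- This `t` balances the two terms of the Cauchy-Schwarz bound; `e1` and `e2` give them the same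
  -- value.
  set t : ℝ := 2 ^ ((n + r - z₁ - m + z₂) / 2) with ht
  have ht0 : 0 < t := by positivity
  have h := traceDist_output_le (deor A) hM hM1 hN hσ ht0
  rw [hσ1] at h
  refine h.trans ?_
  have h2 : (0 : ℝ) < 2 := by norm_num
  have e1 : t⁻¹ * (2 ^ (-z₁) * (2 ^ r * 2 ^ n)) = 2 ^ ((n + r + m - z₁ - z₂) / 2) := by
    rw [ht, ← Real.rpow_neg h2.le, ← Real.rpow_natCast, ← Real.rpow_natCast]
    simp only [← Real.rpow_add h2]
    congr 1
    ring
  have e2 : t * (2 ^ m * 2 ^ (-z₂)) = 2 ^ ((n + r + m - z₁ - z₂) / 2) := by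
    rw [ht, ← Real.rpow_natCast]
    simp only [← Real.rpow_add h2]
    congr 1
    ring
  have e3 : (2 : ℝ) ^ (-((z₁ + z₂ + 2 - n - r - m) / 2))
      = (1 / 2) * 2 ^ ((n + r + m - z₁ - z₂) / 2) := by
    rw [show (1 / 2 : ℝ) = 2 ^ (-1 : ℝ) by rw [Real.rpow_neg_one]; norm_num, ← Real.rpow_add h2]
    congr 1
    ring
  have h5 := mul_le_mul_of_nonneg_left hsum (inv_nonneg.2 ht0.le)
  rw [e1] at h5
  rw [e2, e3]
  linarith

end TwoSource

end Auxiliary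

theorem mainTheorem1 (n m r : ℕ) (A : Fin m → Matrix (Fin n) (Fin n) (ZMod 2))
    (hA : TwoSource.RankCondition A r) (k₁ k₂ : ℝ) :
    TwoSource.IsX1StrongAgainstQuantumProduct (TwoSource.deor A) k₁ k₂
      ((2 : ℝ) ^ (-((k₁ + k₂ + 2 - n - r - m) / 2))) := by
  intro d₁ d₂ ρ₁ ρ₂ hρ₁ hρ₂ h₁ h₂
  obtain ⟨M, hM, hM1, rfl⟩ := TwoSource.exists_blockSum_of_isCQState hρ₁
  obtain ⟨N, hN, hN1, rfl⟩ := TwoSource.exists_blockSum_of_isCQState hρ₂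
  -- The invertible dominating operators need exponents strictly below `k₁` and `k₂`; continuity of
  -- the bound removes the loss `η`.
  have hcont : Continuous fun η : ℝ =>
      (2 : ℝ) ^ (-(((k₁ - η) + (k₂ - η) + 2 - n - r - m) / 2)) :=
    Continuous.rpow continuous_const (by fun_prop) fun _ => Or.inl (by norm_num)
  have hlim := (hcont.tendsto 0).mono_left (nhdsWithin_le_nhds (s := Set.Ioi 0))
  simp only [sub_zero] at hlim
  refine ge_of_tendsto hlim ?_
  filter_upwards [self_mem_nhdsWithin] with η hη
  have hη : 0 < η := hη
  exact TwoSource.traceDist_deor_le hA hM hM1 hN hN1 h₁ h₂ (by linarith) (by linarith)
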